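/- Let $T$ be a complete first-order theory with infinite models, and let $\mathfrak C$ be its monster model. All tuples of variables $\bar x,\bar y_i$ of formulas and of types are finite; a *type* $p(\bar x)$ over a set $B=\mathrm{Dom}(p)$ is a set of formulas with parameters in $B$ that is realized in $\mathfrak C$. **Definitions.** 1. $\kappa^{\mathrm{ict}}(T)>\kappa$ means: for some formulas $\langle\varphi_i(\bar x,\bar y_i):i<\kappa\rangle$ the set $$\{\varphi_i(\bar x_\eta,\bar y_i^{\,j})^{\mathbf{if}(\eta(i)=j)} : i<\kappa,\ j<\omega,\ \eta\in{}^{\kappa}\omega\}$$ is consistent with $T$ (where $\varphi^{\mathbf{if}(\cdot)}$ is $\varphi$ if the condition holds and $\neg\varphi$ otherwise). $\kappa^{\mathrm{ict}}(T)=\kappa$ means that $\kappa^{\mathrm{ict}}(T)>\lambda$ for all $\lambda<\kappa$ but not $\kappa^{\mathrm{ict}}(T)>\kappa$. $T$ is *strongly dependent*$^{1}$ if $\kappa^{\mathrm{ict}}(T)=\aleph_0$. 2. A set of formulas $p(\bar x)$ with parameters in $\mathfrak C$ does *$\mathrm{ict}^1$-$n$-divide* over $A$ if there are a sequence $\langle\bar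 a_t:t\in I\rangle$ that is indexed by a linear order $I$ and indiscernible over $A$, and indices $s_0<t_0\le s_1<t_1\le\dots\le s_{n-1}<t_{n-1}$ in $I$, such that for every $\bar c$ realizing $p$ and every $i<n$, $\mathrm{tp}(\bar c^\frown\bar a_{s_i}/A)\neq\mathrm{tp}(\bar c^\frown\bar a_{t_i}/A)$. It does *$\mathrm{ict}^1$-$n$-fork* over $A$ if there are finitely many formulas $\varphi_i(\bar x,\bar c_i)$, $i<k$, with parameters in $\mathfrak C$, such that $p\vdash\bigvee_{i<k}\varphi_i(\bar x,\bar c_i)$ and each $\varphi_i(\bar x,\bar c_i)$ does $\mathrm{ict}^1$-$n$-divide over $A$. 3. $\kappa_{\mathrm{ict},1}(T)>\kappa$ means: some type $p$ does $\mathrm{ict}^1$-$n$-fork over $A$ for all $n<\omega$ and all $A\subseteq\mathrm{Dom}(p)$ of power $<\kappa$. $T$ is *strongly dependent*$_1$ if $\kappa_{\mathrm{ict},1}(T)=\aleph_0$, that is (the invariant being understood to take infinite values only), if $\kappa_{\mathrm{ict},1}(T)>\aleph_0$ does not hold. **Claim.** If $T$ is strongly dependent$_1$, then $T$ is strongly dependent$^{1}$.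 -/

import Mathlib

open FirstOrder Cardinal

universe u v w w' w''

namespace IctForking

section Types

variable (L : FirstOrder.Language.{u, v}) {N : Type w} [L.Structure N]

/-- The complete type `tp(v̄ / d̄)` in the structure `N`: all formulas, with variables indexed by `β`
and parameters named by the index type `P`, that hold of the tuple `v : β → N` when the parameter
names are interpreted by `d : P → N`. -/
def tp {P : Type w'} {β : Type w''} (d : P → N) (v : β → N) : Set (L.Formula (P ⊕ β)) :=
  {ψ | ψ.Realize (Sum.elim d v)}

/-- `⟨ā_t : t ∈ I⟩` is an indiscernible sequence over the parameters `d` in `N`: any two increasing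
finite tuples of indices of the same length give tuples with the same type over the parameters. -/
def IsIndiscernible {P : Type w'} {I α : Type w} [LinearOrder I] (d : P → N)
    (a : I → α → N) : Prop :=
  ∀ (k : ℕ) (i j : Fin k → I), StrictMono i → StrictMono j →
    tp L d (fun q : Fin k × α => a (i q.1) q.2) = tp L d (fun q : Fin k × α => a (j q.1) q.2)

/-- The tuple `c` of `N` realizes the set of formulas `p(x̄)` with parameters `b`. -/
def Realizes {P : Type w'} {m : ℕ} (b : P → N) (p : Set (L.Formula (P ⊕ Fin m)))
    (c : Fin m → N) : Prop :=
  ∀ φ ∈ p, φ.Realize (Sum.elim b c)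

end Types

/- Elements and sequences of the monster model are taken in elementary extensions of the model `M`
at hand; "every realization in the monster model" is "every realization in every further elementary
extension". The universe `max u v` contains models of all the cardinalities that are needed. -/

section Forking

variable (L : FirstOrder.Language.{u, v}) {M : Type (max u v)} [L.Structure M]

/-- The set of formulas `p(x̄)`, with parameters `b` in `M`, does `ict¹`-`n`-divide over the
parameters `A` in `M`: there are a sequence `⟨ā_t : t ∈ I⟩` indiscernible over `A` and indices
`s₀ < t₀ ≤ s₁ < t₁ ≤ … ≤ s_{n-1} < t_{n-1}` such that every `c̄` realizing `p` satisfies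
`tp(c̄ ⌢ ā_{s_i} / A) ≠ tp(c̄ ⌢ ā_{t_i} / A)` for all `i < n`. -/
def IctDivides (n : ℕ) {P Q : Type (max u v)} {m : ℕ} (A : Q → M) (b : P → M)
    (p : Set (L.Formula (P ⊕ Fin m))) : Prop :=
  ∃ (N : Type (max u v)) (_ : L.Structure N) (e : M ↪ₑ[L] N)
    (I : Type (max u v)) (_ : LinearOrder I) (α : Type (max u v)) (a : I → α → N)
    (s t : Fin n → I),
    IsIndiscernible L (fun q => e (A q)) a ∧
    (∀ i, s i < t i) ∧ (∀ i j, i < j → t i ≤ s j) ∧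
    ∀ (N' : Type (max u v)) (_ : L.Structure N') (e' : N ↪ₑ[L] N') (c : Fin m → N'),
      Realizes L (fun x => e' (e (b x))) p c →
      ∀ i : Fin n,
        tp L (fun q => e' (e (A q))) (Sum.elim c (fun x => e' (a (s i) x))) ≠
        tp L (fun q => e' (e (A q))) (Sum.elim c (fun x => e' (a (t i) x)))

/-- The set of formulas `p(x̄)`, with parameters `b` in `M`, does `ict¹`-`n`-fork over the parameters
`A` in `M`: it implies a finite disjunction of formulas `φ_i(x̄, c̄_i)`, with parameters `c̄_i` from
an elementary extension `N` of `M`, each of which does `ict¹`-`n`-divide over `A`. -/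
def IctForks (n : ℕ) {P Q : Type (max u v)} {m : ℕ} (A : Q → M) (b : P → M)
    (p : Set (L.Formula (P ⊕ Fin m))) : Prop :=
  ∃ (N : Type (max u v)) (_ : L.Structure N) (e : M ↪ₑ[L] N)
    (k : ℕ) (φ : Fin k → L.Formula (N ⊕ Fin m)),
    (∀ (N' : Type (max u v)) (_ : L.Structure N') (e' : N ↪ₑ[L] N') (c : Fin m → N'),
      Realizes L (fun x => e' (e (b x))) p c → ∃ i, (φ i).Realize (Sum.elim (fun x => e' x) c)) ∧
    ∀ i, IctDivides L n (fun q => e (A q)) (fun x : N => x) {φ i}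

/-- The set of formulas `p(x̄)` with parameters `b` in `M` is a (partial) type: it is realized in an
elementary extension of `M`. -/
def IsConsistentType {P : Type (max u v)} {m : ℕ} (b : P → M)
    (p : Set (L.Formula (P ⊕ Fin m))) : Prop :=
  ∃ (N : Type (max u v)) (_ : L.Structure N) (e : M ↪ₑ[L] N) (c : Fin m → N),
    Realizes L (fun x => e (b x)) p c

end Forking

section Invariants

variable {L : FirstOrder.Language.{u, v}} (T : L.Theory)

/-- `κ_{ict,1}(T) > κ`: some type `p(x̄)` over a set `B` of parameters in a model of `T`, in finitely
many variables, does `ict¹`-`n`-fork over `A` for all `n < ω` and all `A ⊆ B` of power `< κ`. -/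
def KappaIctDownGt (κ : Cardinal.{max u v}) : Prop :=
  ∃ (M : Type (max u v)) (_ : L.Structure M) (_ : M ⊨ T) (_ : Nonempty M)
    (m : ℕ) (B : Set M) (p : Set (L.Formula (B ⊕ Fin m))),
    IsConsistentType L (fun x : B => (x : M)) p ∧
    ∀ A : Set M, A ⊆ B → #A < κ → ∀ n : ℕ,
      IctForks L n (fun x : A => (x : M)) (fun x : B => (x : M)) p

/-- `T` is strongly dependent₁: `κ_{ict,1}(T) = ℵ₀`. The invariant takes infinite values only by
convention, so this says exactly that `κ_{ict,1}(T) > ℵ₀` fails. -/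
def StronglyDependentDown : Prop :=
  ¬ KappaIctDownGt T ℵ₀

/-- `κ^{ict}(T) > κ`: for some formulas `φ_i(x̄, ȳ_i)`, `i < κ`, with finite tuples `x̄`, `ȳ_i`, the
set `{φ_i(x̄_η, ȳ_i^j)^{if (η(i) = j)} : i < κ, j < ω, η ∈ ^κ ω}` is consistent with `T`, that is,
it is satisfied by some assignment in some model of `T`. -/
def KappaIctUpGt (κ : Cardinal.{max u v}) : Prop :=
  ∃ (ι : Type (max u v)) (_ : #ι = κ) (m : ℕ) (l : ι → ℕ)
    (φ : (i : ι) → L.Formula (Fin m ⊕ Fin (l i)))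
    (M : Type (max u v)) (_ : L.Structure M) (_ : M ⊨ T) (_ : Nonempty M)
    (x : (ι → ℕ) → Fin m → M) (y : (i : ι) → ℕ → Fin (l i) → M),
    ∀ (η : ι → ℕ) (i : ι) (j : ℕ),
      (η i = j → (φ i).Realize (Sum.elim (x η) (y i j))) ∧
      (η i ≠ j → ¬ (φ i).Realize (Sum.elim (x η) (y i j)))

/-- `κ^{ict}(T) = κ`: `κ^{ict}(T) > μ` holds for all `μ < κ`, but `κ^{ict}(T) > κ` does not. -/
def KappaIctUpEq (κ : Cardinal.{max u v}) : Prop :=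
  (∀ μ < κ, KappaIctUpGt T μ) ∧ ¬ KappaIctUpGt T κ

/-- `T` is strongly dependent¹: `κ^{ict}(T) = ℵ₀`. -/
def StronglyDependentUp : Prop :=
  KappaIctUpEq T ℵ₀

end Invariants

end IctForking

/-!
The proof has two halves.

`κ^{ict}(T) > n` holds for every finite `n` because `T` has an infinite model: the formulas
`x_i = y`, `i < n`, in the tuple `x̄ = (x_0, …, x_{n-1})` form a pattern of depth `n`.

For the other half, let `⟨φ_i(x̄, ȳ_i) : i < ω⟩` form a pattern of depth `ω` in a model `M`, with
array `ȳ_i^j`. The columns `b_j = ⟨ȳ_i^j : i < ω⟩` are replaced by an indiscernible sequence without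
any appeal to Ramsey's theorem or compactness. Fix a nonprincipal ultrafilter `U` on `ℕ`, and choose
an ultrafilter `W` on `ℕ → ℕ` that restricts to the iterated product of `U` on the sets depending on
finitely many coordinates (`sequenceUltrafilter`). In the ultrapower `N` of `M` by `W`, let `a_t` be
the class of `f ↦ b_{f(t)}`. Whether a formula holds of `a_{t_1}, …, a_{t_k}` with
`t_1 < … < t_k` is decided by the `k`-fold product of `U`, hence depends only on `k`
(`eventually_comp_iff_of_strictMono`): the sequence `⟨a_t⟩` is indiscernible. Denote by `a_{t,i}` the
part of `a_t` in row `i`. Since `f(2i) ≠ f(2i+1)` for `W`-almost all `f`, the class of `f ↦ x̄_{η_f}`,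
where `η_f(i) = f(2i)`, realizes
`p(x̄) = {φ_i(x̄, a_{2i,i}) ∧ ¬ φ_i(x̄, a_{2i+1,i}) : i < ω}`.

A finite set `A` of parameters of `p` lies in the columns `a_t` with `t < 2K` for some `K`. The
sequence `⟨a_t : t ≥ 2K⟩` is indiscernible over those columns, and the conjunction of the formulas of
`p` for the rows `K, …, K + n - 1` is violated by no realization of `p`, while each of its own
realizations distinguishes `a_{2i}` from `a_{2i+1}` for these `n` rows `i`. So `p` does
`ict¹`-`n`-fork over `A` for all `n` (`kappaIctDownGt_aleph0_of_kappaIctUpGt`).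
-/

namespace IctForking

open Filter FirstOrder.Language

/-! ### Iterated products of an ultrafilter -/

/-- The `n`-fold product of the ultrafilter `U` on `ℕ`, as an ultrafilter on `ℕ → ℕ`: a set is large
if it contains `f` for `U`-almost all `f 0`, then `U`-almost all `f 1`, …, then `U`-almost all
`f (n - 1)`. The remaining coordinates are `0`. -/
noncomputable def iteratedUltrafilter (U : Ultrafilter ℕ) : ℕ → Ultrafilter (ℕ → ℕ)
  | 0 => pure 0
  | n + 1 => (iteratedUltrafilter U n).bind fun f => U.map (Function.update f n)

theorem eventually_iteratedUltrafilter_succ (U : Ultrafilter ℕ) (n : ℕ) (P : (ℕ → ℕ) → Prop) :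
    (∀ᶠ f in (iteratedUltrafilter U (n + 1) : Filter (ℕ → ℕ)), P f) ↔
      ∀ᶠ f in (iteratedUltrafilter U n : Filter (ℕ → ℕ)), ∀ᶠ a in (U : Filter ℕ),
        P (Function.update f n a) :=
  Iff.rfl

/-- Coordinates that a condition does not mention can be dropped from the iterated quantifier, so a
condition on `k` coordinates in increasing order is decided by the `k`-fold product. -/
theorem eventually_iteratedUltrafilter_comp (U : Ultrafilter ℕ) (n : ℕ) :
    ∀ (k : ℕ) (i : Fin k → ℕ), StrictMono i → (∀ q, i q < n) → ∀ P : (Fin k → ℕ) → Prop,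
      (∀ᶠ f in (iteratedUltrafilter U n : Filter (ℕ → ℕ)), P (f ∘ i)) ↔
        ∀ᶠ f in (iteratedUltrafilter U k : Filter (ℕ → ℕ)), P (f ∘ Fin.val) := by
  induction n with
  | zero =>
    intro k i _ hn P
    obtain rfl : k = 0 := by
      by_contra hk
      exact absurd (hn ⟨0, Nat.pos_of_ne_zero hk⟩) (Nat.not_lt_zero _)
    rw [Subsingleton.elim i Fin.val]
  | succ n ih =>
    intro k i hi hn P
    rw [eventually_iteratedUltrafilter_succ]
    by_cases hlast : ∀ q, i q < n
    · rw [← ih k i hi hlast P]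
      refine eventually_congr (Eventually.of_forall fun f => ?_)
      have hupd : ∀ a, Function.update f n a ∘ i = f ∘ i := fun a => by
        funext q
        simp [Function.update_of_ne (hlast q).ne]
      simp only [hupd, eventually_const]
    · -- The largest index equals `n`: it is quantified last on both sides.
      push Not at hlast
      obtain ⟨q₀, hq₀⟩ := hlast
      obtain ⟨k, rfl⟩ : ∃ k', k = k' + 1 := ⟨k - 1, by have := q₀.isLt; omega⟩
      have hl : i (Fin.last k) = n :=
        le_antisymm (Nat.lt_succ_iff.1 (hn _)) (hq₀.trans (hi.monotone (Fin.le_last _)))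
      have hc : ∀ q : Fin k, i q.castSucc < n := fun q =>
        hl ▸ hi (Fin.castSucc_lt_last q)
      have h1 : ∀ (f : ℕ → ℕ) a, Function.update f n a ∘ i =
          Fin.snoc (α := fun _ => ℕ) (f ∘ (i ∘ Fin.castSucc)) a := fun f a => by
        funext q
        refine Fin.lastCases ?_ (fun q => ?_) q
        · simp [hl]
        · simp [Function.update_of_ne (hc q).ne]
      have h2 : ∀ (f : ℕ → ℕ) a, Function.update f k a ∘ (Fin.val : Fin (k + 1) → ℕ) =
          Fin.snoc (α := fun _ => ℕ) (f ∘ (Fin.val : Fin k → ℕ)) a := fun f a => by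
        funext q
        refine Fin.lastCases ?_ (fun q => ?_) q
        · simp
        · simp [Function.update_of_ne q.isLt.ne]
      rw [eventually_iteratedUltrafilter_succ]
      simp only [h1, h2]
      exact ih k (i ∘ Fin.castSucc) (hi.comp Fin.strictMono_castSucc) hc
        fun w => ∀ᶠ a in (U : Filter ℕ), P (Fin.snoc (α := fun _ => ℕ) w a)

/-- A limit of the finite products of `U`: an ultrafilter on `ℕ → ℕ` that agrees with
`iteratedUltrafilter U n` on the sets depending on the first `n` coordinates only. -/
noncomputable def sequenceUltrafilter (U : Ultrafilter ℕ) : Ultrafilter (ℕ → ℕ) :=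
  (hyperfilter ℕ).bind (iteratedUltrafilter U)

theorem eventually_sequenceUltrafilter_comp (U : Ultrafilter ℕ) {k : ℕ} {i : Fin k → ℕ}
    (hi : StrictMono i) (P : (Fin k → ℕ) → Prop) :
    (∀ᶠ f in (sequenceUltrafilter U : Filter (ℕ → ℕ)), P (f ∘ i)) ↔
      ∀ᶠ f in (iteratedUltrafilter U k : Filter (ℕ → ℕ)), P (f ∘ Fin.val) := by
  have hbd : ∀ᶠ n in (hyperfilter ℕ : Filter ℕ), ∀ q, i q < n := by
    refine Nat.hyperfilter_le_atTop ?_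
    exact eventually_all.2 fun q => eventually_gt_atTop (i q)
  have hiff : ∀ᶠ n in (hyperfilter ℕ : Filter ℕ),
      ((∀ᶠ f in (iteratedUltrafilter U n : Filter (ℕ → ℕ)), P (f ∘ i)) ↔
        ∀ᶠ f in (iteratedUltrafilter U k : Filter (ℕ → ℕ)), P (f ∘ Fin.val)) :=
    hbd.mono fun n hn => eventually_iteratedUltrafilter_comp U n k i hi hn P
  exact (eventually_congr hiff).trans eventually_const

/-- The coordinates of a `sequenceUltrafilter U`-generic sequence are indiscernible. -/
theorem eventually_comp_iff_of_strictMono (U : Ultrafilter ℕ) {k : ℕ} {i j : Fin k → ℕ}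
    (hi : StrictMono i) (hj : StrictMono j) (P : (Fin k → ℕ) → Prop) :
    (∀ᶠ f in (sequenceUltrafilter U : Filter (ℕ → ℕ)), P (f ∘ i)) ↔
      ∀ᶠ f in (sequenceUltrafilter U : Filter (ℕ → ℕ)), P (f ∘ j) :=
  (eventually_sequenceUltrafilter_comp U hi P).trans
    (eventually_sequenceUltrafilter_comp U hj P).symm

theorem eventually_sequenceUltrafilter_ne {U : Ultrafilter ℕ} (hU : (U : Filter ℕ) ≤ cofinite)
    {s t : ℕ} (hst : s < t) :
    ∀ᶠ f in (sequenceUltrafilter U : Filter (ℕ → ℕ)), f s ≠ f t := by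
  have hmono : StrictMono ![s, t] := by
    intro a b hab
    fin_cases a <;> fin_cases b <;> simp_all
  refine (eventually_sequenceUltrafilter_comp U hmono fun w => w 0 ≠ w 1).2 ?_
  rw [eventually_iteratedUltrafilter_succ]
  refine Eventually.of_forall fun f => ?_
  have hne : ∀ᶠ a in (U : Filter ℕ), a ≠ f 0 := hU (Set.finite_singleton (f 0)).compl_mem_cofinite
  filter_upwards [hne] with a ha
  simpa [Function.update_of_ne] using ha.symm

/-! ### Indiscernible sequences in ultrapowers -/

section Ultrapower

variable {L : FirstOrder.Language.{u, v}} {M : Type w}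

/-- The element of the ultrapower of `M` by `sequenceUltrafilter U` represented by `g`. -/
noncomputable def toUltrapower (U : Ultrafilter ℕ) (g : (ℕ → ℕ) → M) :
    (sequenceUltrafilter U : Filter (ℕ → ℕ)).Product fun _ => M :=
  Quotient.mk'' g

theorem realize_toUltrapower [L.Structure M] [Nonempty M] (U : Ultrafilter ℕ) {β : Type w'}
    {γ : Type w''} (ψ : L.Formula (β ⊕ γ)) (g : β → (ℕ → ℕ) → M) (h : γ → (ℕ → ℕ) → M) :
    ψ.Realize (Sum.elim (fun x => toUltrapower U (g x)) fun x => toUltrapower U (h x)) ↔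
      ∀ᶠ f in (sequenceUltrafilter U : Filter (ℕ → ℕ)),
        ψ.Realize (Sum.elim (fun x => g x f) fun x => h x f) := by
  have hL : (Sum.elim (fun x => toUltrapower U (g x)) fun x => toUltrapower U (h x)) =
      fun x => toUltrapower U (Sum.elim g h x) := by
    funext x
    cases x <;> rfl
  have hR : ∀ f, (Sum.elim (fun x => g x f) fun x => h x f) = fun x => Sum.elim g h x f := by
    intro f
    funext x
    cases x <;> rfl
  simp only [hL, hR]
  exact Ultraproduct.realize_formula_cast ψ (Sum.elim g h)

/-- The sequence of the classes of `f ↦ y (f t)`, `t ≥ K`, is indiscernible over the entries of its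
terms with `t < K`. -/
theorem isIndiscernible_toUltrapower [L.Structure M] [Nonempty M] (U : Ultrafilter ℕ)
    {α : Type w} (y : ℕ → α → M) (K : ℕ) {P : Type w'} (τ : P → ℕ) (hτ : ∀ q, τ q < K)
    (x : P → α) :
    IsIndiscernible L (fun q => toUltrapower U fun f => y (f (τ q)) (x q))
      (fun (t : ULift.{w} ℕ) (z : α) => toUltrapower U fun f => y (f (K + t.down)) z) := by
  intro k i j hi hj
  -- The parameters are treated as further terms of the sequence, in front of the given ones.
  let ext (i : Fin k → ULift.{w} ℕ) : Fin (K + k) → ℕ :=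
    Fin.append (fun r : Fin K => (r : ℕ)) fun r => K + (i r).down
  have hext : ∀ i : Fin k → ULift.{w} ℕ, StrictMono i → StrictMono (ext i) := by
    intro i hi a b
    refine Fin.addCases (fun a => ?_) (fun a => ?_) a <;>
      refine Fin.addCases (fun b => ?_) (fun b => ?_) b <;> intro hab <;>
      simp only [ext, Fin.append_left, Fin.append_right]
    · exact hab
    · exact a.isLt.trans_le (Nat.le_add_right _ _)
    · rw [Fin.lt_def] at hab
      simp only [Fin.val_natAdd, Fin.val_castAdd] at hab
      have := b.isLt
      omega
    · exact Nat.add_lt_add_left (hi ((Fin.natAdd_lt_natAdd_iff K).1 hab)) K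
  let R (ψ : L.Formula (P ⊕ (Fin k × α))) (w : Fin (K + k) → ℕ) : Prop :=
    ψ.Realize (Sum.elim (fun q => y (w (Fin.castAdd k ⟨τ q, hτ q⟩)) (x q))
      fun q : Fin k × α => y (w (Fin.natAdd K q.1)) q.2)
  have key : ∀ (i : Fin k → ULift.{w} ℕ) (ψ : L.Formula (P ⊕ (Fin k × α))),
      (ψ.Realize (Sum.elim (fun q => toUltrapower U fun f => y (f (τ q)) (x q))
        fun q : Fin k × α => toUltrapower U fun f => y (f (K + (i q.1).down)) q.2)) ↔
      ∀ᶠ f in (sequenceUltrafilter U : Filter (ℕ → ℕ)), R ψ (f ∘ ext i) := by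
    intro i ψ
    simp only [realize_toUltrapower, R, Function.comp_apply, ext, Fin.append_left,
      Fin.append_right]
  ext ψ
  exact ((key i ψ).trans
    (eventually_comp_iff_of_strictMono U (hext i hi) (hext j hj) (R ψ))).trans (key j ψ).symm

end Ultrapower

/-! ### Finite patterns -/

theorem kappaIctUpGt_of_lt_aleph0 {L : FirstOrder.Language.{u, v}} (T : L.Theory)
    (hinf : ∃ M : FirstOrder.Language.Theory.ModelType.{u, v, max u v} T, Infinite M)
    {μ : Cardinal.{max u v}} (hμ : μ < ℵ₀) : KappaIctUpGt T μ := by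
  obtain ⟨M, hM⟩ := hinf
  obtain ⟨n, rfl⟩ := Cardinal.lt_aleph0.1 hμ
  let y : ℕ ↪ M := Infinite.natEmbedding M
  refine ⟨ULift.{max u v} (Fin n), by simp, n, fun _ => 1,
    fun i => Term.equal (Term.var (Sum.inl i.down)) (Term.var (Sum.inr 0)),
    M, inferInstance, inferInstance, inferInstance,
    fun η i => y (η ⟨i⟩), fun _ j _ => y j, fun η i j => ?_⟩
  simp [Formula.realize_equal, y.injective.eq_iff]

/-! ### Infinite patterns -/

section Dividing

variable {L : FirstOrder.Language.{u, v}} {M : Type (max u v)} [L.Structure M]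

/-- A set of formulas divides along an indiscernible sequence of `M` itself as soon as each of its
realizations is separated on every pair of indices by a formula without further parameters. -/
theorem ictDivides_of_formulas {n : ℕ} {P Q : Type (max u v)} {m : ℕ} {A : Q → M} {b : P → M}
    {p : Set (L.Formula (P ⊕ Fin m))} {I α : Type (max u v)} [LinearOrder I] {a : I → α → M}
    (ha : IsIndiscernible L A a) (s t : Fin n → I) (hst : ∀ i, s i < t i)
    (hts : ∀ i j, i < j → t i ≤ s j) (ψ : Fin n → L.Formula (Fin m ⊕ α))
    (h : ∀ (N : Type (max u v)) (_ : L.Structure N) (e : M ↪ₑ[L] N) (c : Fin m → N),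
      Realizes L (fun x => e (b x)) p c → ∀ i,
        (ψ i).Realize (Sum.elim c fun x => e (a (s i) x)) ∧
        ¬ (ψ i).Realize (Sum.elim c fun x => e (a (t i) x))) :
    IctDivides L n A b p := by
  refine ⟨M, inferInstance, ElementaryEmbedding.refl L M, I, inferInstance, α, a, s, t, ha, hst, hts,
    fun N _ e c hc i heq => ?_⟩
  obtain ⟨h1, h2⟩ := h N _ e c hc i
  refine h2 ?_
  have := Set.ext_iff.1 heq ((ψ i).relabel Sum.inr)
  simp only [tp, Set.mem_ofPred_eq, Formula.realize_relabel, Sum.elim_comp_inr] at this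
  exact this.1 h1

end Dividing

/-- A pattern of depth `ω` yields, in an ultrapower, a type that forks over every finite set of its
parameters: row `i` changes its truth value between the columns `2i` and `2i + 1`. -/
theorem kappaIctDownGt_aleph0_of_kappaIctUpGt {L : FirstOrder.Language.{u, v}} (T : L.Theory)
    (h : KappaIctUpGt T ℵ₀) : KappaIctDownGt T ℵ₀ := by
  obtain ⟨ι, hι, m, l, φ, M, _, hMT, _, x, y, hxy⟩ := h
  obtain ⟨r⟩ : Nonempty (ι ≃ ℕ) := by
    rw [← Cardinal.lift_mk_eq', hι]
    simp
  let U : Ultrafilter ℕ := hyperfilter ℕ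
  let α := Σ i : ι, Fin (l i)
  let N := (sequenceUltrafilter U : Filter (ℕ → ℕ)).Product fun _ => M
  let a : ℕ → α → N := fun t z => toUltrapower U fun f => y z.1 (f t) z.2
  let c : Fin m → N := fun q => toUltrapower U fun f => x (fun i => f (2 * r i)) q
  have hNT : N ⊨ T := ⟨fun σ hσ =>
    (Ultraproduct.sentence_realize σ).2 (Eventually.of_forall fun _ => hMT.realize_of_mem σ hσ)⟩
  let B : Set N := Set.range fun z : ℕ × α => a z.1 z.2
  let row (t : ℕ) (i : ι) : L.Formula (B ⊕ Fin m) :=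
    (φ i).relabel (Sum.elim Sum.inr fun q => Sum.inl ⟨a t ⟨i, q⟩, (t, ⟨i, q⟩), rfl⟩)
  have hrow : ∀ (N' : Type (max u v)) (_ : L.Structure N') (e : N → N') (c' : Fin m → N') t i,
      (row t i).Realize (Sum.elim (fun z : B => e z) c') ↔
        (φ i).Realize (Sum.elim c' fun q => e (a t ⟨i, q⟩)) := by
    intro N' _ e c' t i
    rw [Formula.realize_relabel]
    congr! 1
    funext z
    cases z <;> rfl
  let p : Set (L.Formula (B ⊕ Fin m)) :=
    Set.range fun i => row (2 * r i) i ⊓ ∼(row (2 * r i + 1) i)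
  have hp : ∀ (N' : Type (max u v)) (_ : L.Structure N') (e : N → N') (c' : Fin m → N'),
      Realizes L (fun z : B => e z) p c' ↔ ∀ i,
        (φ i).Realize (Sum.elim c' fun q => e (a (2 * r i) ⟨i, q⟩)) ∧
        ¬ (φ i).Realize (Sum.elim c' fun q => e (a (2 * r i + 1) ⟨i, q⟩)) := by
    intro N' _ e c'
    simp only [Realizes, p, Set.forall_mem_range, Formula.realize_inf, Formula.realize_not, hrow]
  have hφ : ∀ t i, (φ i).Realize (Sum.elim c fun q => a t ⟨i, q⟩) ↔
      ∀ᶠ f in (sequenceUltrafilter U : Filter (ℕ → ℕ)),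
        (φ i).Realize (Sum.elim (x fun i => f (2 * r i)) (y i (f t))) := by
    intro t i
    exact realize_toUltrapower U (φ i) _ _
  refine ⟨N, inferInstance, hNT, inferInstance, m, B, p,
    ⟨N, inferInstance, ElementaryEmbedding.refl L N, c, ?_⟩, fun A hAB hA n => ?_⟩
  · refine (hp N _ id c).2 fun i => ⟨(hφ _ i).2 ?_, fun hc => ?_⟩
    · exact Eventually.of_forall fun f => (hxy _ i _).1 rfl
    · have hne := eventually_sequenceUltrafilter_ne (U := U) hyperfilter_le_cofinite
        (Nat.lt_succ_self (2 * r i))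
      obtain ⟨f, hf, hf'⟩ := (((hφ _ i).1 hc).and hne).exists
      exact (hxy _ i _).2 hf' hf
  · have hAfin : Finite A := Cardinal.lt_aleph0_iff_finite.1 hA
    choose z hz using fun q : A => hAB q.2
    obtain ⟨K, hK⟩ : ∃ K, ∀ q, (z q).1 < 2 * K := by
      obtain ⟨K, hK⟩ := (Set.finite_range fun q => (z q).1).bddAbove
      exact ⟨K + 1, fun q => by have := hK ⟨q, rfl⟩; dsimp only at this; omega⟩
    -- The row used for the `i`-th pair of indices.
    let ρ : Fin n → ι := fun i => r.symm (K + i)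
    have hρ : ∀ i, r (ρ i) = K + i := fun i => r.apply_symm_apply _
    let χ : L.Formula (N ⊕ Fin m) := Formula.iInf fun i : Fin n =>
      (row (2 * r (ρ i)) (ρ i) ⊓ ∼(row (2 * r (ρ i) + 1) (ρ i))).relabel
        (Sum.map (Subtype.val : B → N) id)
    have hχ : ∀ (N' : Type (max u v)) (_ : L.Structure N') (e : N → N') (c' : Fin m → N'),
        χ.Realize (Sum.elim e c') ↔ ∀ i,
          (φ (ρ i)).Realize (Sum.elim c' fun q => e (a (2 * r (ρ i)) ⟨ρ i, q⟩)) ∧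
          ¬ (φ (ρ i)).Realize (Sum.elim c' fun q => e (a (2 * r (ρ i) + 1) ⟨ρ i, q⟩)) := by
      intro N' _ e c'
      simp only [χ, Formula.realize_iInf, Formula.realize_relabel, Sum.elim_comp_map,
        Function.comp_id, Formula.realize_inf, Formula.realize_not]
      exact forall_congr' fun i => and_congr (hrow N' _ e c' _ _) (not_congr (hrow N' _ e c' _ _))
    refine ⟨N, inferInstance, ElementaryEmbedding.refl L N, 1, fun _ => χ,
      fun N' _ e c' hc' => ⟨0, ?_⟩, fun _ => ?_⟩
    · exact (hχ N' _ e c').2 fun i => (hp N' _ e c').1 hc' (ρ i)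
    · have hind := isIndiscernible_toUltrapower (L := L) U (fun j (z : α) => y z.1 j z.2) (2 * K)
        (fun q : A => (z q).1) hK fun q => (z q).2
      have hA : (fun q : A => toUltrapower U fun f => y (z q).2.1 (f (z q).1) (z q).2.2) =
          fun q : A => (q : N) := funext hz
      rw [hA] at hind
      refine ictDivides_of_formulas hind (fun i => ⟨2 * i⟩) (fun i => ⟨2 * i + 1⟩)
        (fun i => Nat.lt_succ_self (2 * (i : ℕ))) (fun i j hij => ?_)
        (fun i => (φ (ρ i)).relabel (Sum.map id fun q => ⟨ρ i, q⟩)) fun N' _ e c' hc' i => ?_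
      · have hij' : (i : ℕ) < j := hij
        exact (show 2 * (i : ℕ) + 1 ≤ 2 * j by omega)
      · have := (hχ N' _ e c').1 (hc' _ rfl) i
        rw [hρ, Nat.mul_add] at this
        simp only [Formula.realize_relabel, Sum.elim_comp_map, Function.comp_id]
        exact this

end IctForking

theorem mainTheorem2 {L : FirstOrder.Language.{u, v}} (T : L.Theory) (hT : T.IsComplete)
    (hinf : ∃ M : FirstOrder.Language.Theory.ModelType.{u, v, max u v} T, Infinite M)
    (h : IctForking.StronglyDependentDown T) :
    IctForking.StronglyDependentUp T :=
  ⟨fun _ hμ => IctForking.kappaIctUpGt_of_lt_aleph0 T hinf hμ,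
    fun hup => h (IctForking.kappaIctDownGt_aleph0_of_kappaIctUpGt T hup)⟩
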